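/- Let $\eta$ be a Borel probability measure on $(0,\infty)$ whose support (in $\mathbb{R}$) is compact and which is absolutely continuous with respect to Lebesgue measure, with a density $d\eta/dx$ of bounded variation. Put $\chi(\eta)=\int \log x\,d\eta(x)$ and suppose that $\chi(\eta)<0$. Let $\eta_\infty=\eta^{\mathbb{N}}$ be the infinite product measure on $\mathbb{R}^{\mathbb{N}}$. Let $m\ge 1$, let $d_1,\dots,d_m$ be distinct real numbers, and for ${\bf y}=(y_1,y_2,\dots)$ let $$S({\bf y})=\Big\{\sum_{i=1}^\infty d_{a_i}\,y_1 y_2\cdots y_{i-1}\ :\ (a_i)_{i\ge 1}\in\{1,\dots,m\}^{\mathbb{N}}\Big\},$$ where the empty product (for $i=1$) equals $1$; for $\eta_\infty$-a.e. ${\bf y}$ all these series converge absolutely. Then: (a) If $\log m>2|\chi(\eta)|$, then for $\eta_\infty$-a.e. ${\bf y}$ the set $S({\bf y})$ contains a non-degenerate interval. (b) If $\log m\le|\chi(\eta)|$, then $\dim_H S({\bf y})=\log m/|\chi(\eta)|$ for $\eta_\infty$-a.e. ${\bf y}$. -/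

import Mathlib

open MeasureTheory Set

/-- `η` has a density with respect to Lebesgue measure that (in a suitable version) is a function
of bounded variation on `ℝ`. -/
def HasBVDensity (η : Measure ℝ) : Prop :=
  ∃ f : ℝ → ℝ, (∀ x, 0 ≤ f x) ∧ BoundedVariationOn f univ ∧
    η = volume.withDensity (fun x => ENNReal.ofReal (f x))

/-- The exponent `χ(η) = ∫ log x dη(x)`. -/
noncomputable def lyapunovExponent (η : Measure ℝ) : ℝ := ∫ x, Real.log x ∂η

/-- The terms of the series coded by `a ∈ {1, …, m}^ℕ`: with all indices starting at `0`, the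
`i`-th term is `d_{a_i} y_0 ⋯ y_{i-1}`. -/
def seriesTerm {m : ℕ} (d : Fin m → ℝ) (y : ℕ → ℝ) (a : ℕ → Fin m) (i : ℕ) : ℝ :=
  d (a i) * ∏ j ∈ Finset.range i, y j

/-- The set `S(y)` of the sums of all the series coded by sequences `a ∈ {1, …, m}^ℕ`. -/
def sumSet {m : ℕ} (d : Fin m → ℝ) (y : ℕ → ℝ) : Set ℝ :=
  {x | ∃ a : ℕ → Fin m, HasSum (seriesTerm d y a) x}

/-!
For fixed errors `y`, let the digits `a_i` be independent and uniformly distributed. The law of the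
sum `∑ d_{a_i} y_0 ⋯ y_{i-1}` is a measure carried by the compact set `S(y)`, and everything follows
from an estimate for the probability that two independent sums are within `r` of each other
(`exists_lintegral_overlap_le`).

Two digit sequences that first differ at `k` have sums whose difference is `y_0 ⋯ y_{k-1} (c + y_k W)`,
where `c = d_{a_k} - d_{b_k}` is bounded away from `0` and `W` does not involve `y_0, …, y_k`. As `y_k` is
bounded and has a bounded density, this is at most `r` with probability `O(r / ρ)`, uniformly in all other
errors for which `y_0 ⋯ y_{k-1} ≥ ρ` (`measure_codedSum_close_le`): if `W` is so small that moving `y_k`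
has little effect, then `c + y_k W` is not small in the first place. By the strong law of large numbers
`y_0 ⋯ y_{k-1}` is almost surely at least a constant times `e^{-lk}`, for every `l > |χ|`. As a pair of
sequences agrees up to `k` with probability `m^{-k}`, the two sums are within `r` with probability
`O(r^s)` on average, for every `s ≤ 1` with `s l < log m`.

If `log m ≤ |χ|`, this bounds the dimension of `S(y)` from below by every `s < log m / |χ|`
(`le_dimH_of_tsum_ne_top`), and the cover by cylinder sets (`dimH_range_codedSum_le`) gives the upper
bound.

If `log m > 2 |χ|`, the digits at even and at odd positions write `S(y)` as `A(y) + y_0 A(y_1, y_2, …)`, where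
`A(y)` is the set of the sums `∑ d_{a_i} y_0 ⋯ y_{2i-1}` (`add_mem_sumSet`). Here each step multiplies by
two errors, so the exponent is `2χ`, and the estimate with `s = 1` shows that both sets have positive
Lebesgue measure (`volume_pos_of_liminf_ne_top`). By Steinhaus' theorem their sum contains an interval
(`exists_Icc_subset_add`). In the lemmas `q ∈ {1, 2}` is the number of errors used in each step.
-/

open Filter Topology
open scoped ENNReal NNReal

/-! ### Resampling one coordinate of a product measure -/

/-- Replacing one coordinate by an independent copy does not change the law. This is how a single
error is integrated out while all others stay fixed. -/
theorem map_update_prod_infinitePi {ι : Type*} [DecidableEq ι] {X : ι → Type*}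
    [∀ i, MeasurableSpace (X i)] (μ : ∀ i, Measure (X i)) [∀ i, IsProbabilityMeasure (μ i)]
    (j : ι) :
    ((Measure.infinitePi μ).prod (μ j)).map (fun p => Function.update p.1 j p.2) =
      Measure.infinitePi μ := by
  have hmeas : Measurable fun p : (∀ i, X i) × X j => Function.update p.1 j p.2 := by
    refine measurable_pi_iff.2 fun i => ?_
    by_cases h : i = j
    · subst h; simpa using measurable_snd
    · simp only [Function.update_of_ne h]; fun_prop
  refine Measure.eq_infinitePi μ fun s t ht => ?_
  rw [Measure.map_apply hmeas (.pi s.countable_toSet fun i _ => ht i)]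
  have hpre : (fun p : (∀ i, X i) × X j => Function.update p.1 j p.2) ⁻¹' (Set.pi s t) =
      (Set.pi (s.erase j : Finset ι) t) ×ˢ (if j ∈ s then t j else univ) := by
    ext ⟨y, x⟩
    simp only [mem_preimage, Set.mem_pi, Finset.mem_coe, mem_prod, Finset.mem_erase]
    constructor
    · intro h
      refine ⟨fun i hi => by simpa [hi.1] using h i hi.2, ?_⟩
      split_ifs with hj
      · simpa using h j hj
      · trivial
    · rintro ⟨h1, h2⟩ i hi
      by_cases hij : i = j
      · subst hij; simpa [hi] using h2
      · simpa [hij] using h1 i ⟨hij, hi⟩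
  rw [hpre, Measure.prod_prod, Measure.infinitePi_pi μ fun i _ => ht i]
  split_ifs with hj
  · rw [mul_comm, Finset.mul_prod_erase s (fun i => μ i (t i)) hj]
  · rw [measure_univ, mul_one, Finset.erase_eq_of_notMem hj]

/-! ### Correlation of a measure, Lebesgue measure and dimension of its carriers -/

theorem measurableSet_dist_le (r : ℝ) : MeasurableSet {p : ℝ × ℝ | dist p.1 p.2 ≤ r} :=
  measurableSet_le (by fun_prop) measurable_const

theorem prod_dist_le_eq_lintegral (κ : Measure ℝ) [IsProbabilityMeasure κ] (r : ℝ) :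
    (κ.prod κ) {p | dist p.1 p.2 ≤ r} = ∫⁻ x, κ (Metric.closedBall x r) ∂κ := by
  rw [Measure.prod_apply (measurableSet_dist_le r)]
  congr! with x
  ext z
  simp [dist_comm]

theorem measurable_measure_closedBall (κ : Measure ℝ) [IsProbabilityMeasure κ] (r : ℝ) :
    Measurable fun x => κ (Metric.closedBall x r) := by
  have := measurable_measure_prodMk_left (ν := κ) (measurableSet_dist_le r)
  convert this using 3 with x
  ext z
  simp [dist_comm]

/-- If `κ` lives on `A`, then the function `x ↦ κ (closedBall x r)` has integral `2r`, vanishes off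
the closed `r`-neighbourhood of `A`, and the integral of its square is at most `2r` times the
`κ × κ`-measure of the pairs at distance at most `2r`; the Cauchy-Schwarz inequality gives the
claim. -/
theorem le_volume_cthickening_mul (κ : Measure ℝ) [IsProbabilityMeasure κ] {A : Set ℝ}
    (hA : κ Aᶜ = 0) {r : ℝ} (hr : 0 < r) :
    ENNReal.ofReal (2 * r) ≤
      volume (Metric.cthickening r A) * (κ.prod κ) {p | dist p.1 p.2 ≤ 2 * r} := by
  set T := Metric.cthickening r A
  have hT : MeasurableSet T := Metric.isClosed_cthickening.measurableSet
  set g : ℝ → ℝ≥0∞ := fun x => κ (Metric.closedBall x r) with hg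
  have hgm : Measurable g := measurable_measure_closedBall κ r
  have hball : ∀ x, g x = ∫⁻ z, (Metric.closedBall z r).indicator 1 x ∂κ := fun x => by
    simp only [hg]
    rw [← lintegral_indicator_one Metric.isClosed_closedBall.measurableSet]
    congr! 2 with z
    simp [indicator, dist_comm]
  have hjoint : Measurable fun p : ℝ × ℝ => (Metric.closedBall p.2 r).indicator
      (1 : ℝ → ℝ≥0∞) p.1 := by
    have : (fun p : ℝ × ℝ => (Metric.closedBall p.2 r).indicator (1 : ℝ → ℝ≥0∞) p.1) =
        {p : ℝ × ℝ | dist p.1 p.2 ≤ r}.indicator 1 := by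
      ext p; simp [indicator]
    rw [this]
    exact measurable_one.indicator (measurableSet_dist_le r)
  have hint : ∫⁻ x, g x = ENNReal.ofReal (2 * r) := by
    simp_rw [hball]
    rw [lintegral_lintegral_swap hjoint.aemeasurable]
    simp [lintegral_indicator_one Metric.isClosed_closedBall.measurableSet]
  have hsq : ∫⁻ x, g x ^ 2 ≤
      ENNReal.ofReal (2 * r) * (κ.prod κ) {p | dist p.1 p.2 ≤ 2 * r} := by
    calc ∫⁻ x, g x ^ 2
        = ∫⁻ x, ∫⁻ z, ∫⁻ w, (Metric.closedBall z r).indicator 1 x *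
            (Metric.closedBall w r).indicator 1 x ∂κ ∂κ := by
          refine lintegral_congr fun x => ?_
          have hm : Measurable fun z => (Metric.closedBall z r).indicator (1 : ℝ → ℝ≥0∞) x :=
            hjoint.comp (measurable_const.prodMk measurable_id)
          simp_rw [lintegral_const_mul _ hm]
          rw [lintegral_mul_const _ hm, ← hball, sq]
      _ = ∫⁻ p : ℝ × ℝ, (∫⁻ x : ℝ, (Metric.closedBall p.1 r).indicator 1 x *
            (Metric.closedBall p.2 r).indicator 1 x) ∂(κ.prod κ) := by
          have hm3 : Measurable fun t : ℝ × ℝ × ℝ =>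
              (Metric.closedBall t.2.1 r).indicator (1 : ℝ → ℝ≥0∞) t.1 *
              (Metric.closedBall t.2.2 r).indicator (1 : ℝ → ℝ≥0∞) t.1 :=
            (hjoint.comp (measurable_fst.prodMk measurable_snd.fst)).mul
              (hjoint.comp (measurable_fst.prodMk measurable_snd.snd))
          rw [← lintegral_lintegral_swap (μ := volume) (ν := κ.prod κ)
            (f := fun x p => (Metric.closedBall p.1 r).indicator (1 : ℝ → ℝ≥0∞) x *
              (Metric.closedBall p.2 r).indicator (1 : ℝ → ℝ≥0∞) x) hm3.aemeasurable]
          refine lintegral_congr fun x => ?_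
          exact (lintegral_prod (fun p : ℝ × ℝ =>
            (Metric.closedBall p.1 r).indicator (1 : ℝ → ℝ≥0∞) x *
              (Metric.closedBall p.2 r).indicator (1 : ℝ → ℝ≥0∞) x)
            (hm3.comp (measurable_const.prodMk measurable_id)).aemeasurable).symm
      _ ≤ ∫⁻ p : ℝ × ℝ, ({p : ℝ × ℝ | dist p.1 p.2 ≤ 2 * r}.indicator
            (fun _ => ENNReal.ofReal (2 * r)) p) ∂(κ.prod κ) := by
          refine lintegral_mono fun p => ?_
          by_cases hp : dist p.1 p.2 ≤ 2 * r
          · rw [indicator_of_mem (by exact hp)]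
            calc _ ≤ ∫⁻ x, (Metric.closedBall p.1 r).indicator 1 x := by
                  refine lintegral_mono fun x => ?_
                  refine mul_le_of_le_one_right' ?_
                  exact indicator_le_self' (by simp) x
              _ = _ := by
                  simp [lintegral_indicator_one Metric.isClosed_closedBall.measurableSet]
          · rw [indicator_of_notMem (by exact hp)]
            refine le_of_eq ?_
            rw [← lintegral_zero (μ := (volume : Measure ℝ))]
            refine lintegral_congr fun x => ?_
            by_cases h1 : x ∈ Metric.closedBall p.1 r
            · have h2 : x ∉ Metric.closedBall p.2 r := fun h2 => hp <| by
                have := dist_triangle_left p.1 p.2 x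
                simp only [Metric.mem_closedBall] at h1 h2
                linarith
              simp [indicator_of_notMem h2]
            · simp [indicator_of_notMem h1]
      _ = _ := by
          rw [lintegral_indicator_const (measurableSet_dist_le _)]
  have hzero : ∀ x, x ∉ T → g x = 0 := by
    intro x hx
    refine measure_mono_null (t := Aᶜ) (fun z hz hzA => hx ?_) hA
    exact Metric.mem_cthickening_of_dist_le x z r A hzA (by rwa [dist_comm])
  have hCS := ENNReal.lintegral_mul_le_Lp_mul_Lq (volume : Measure ℝ) Real.HolderConjugate.two_two
    hgm.aemeasurable ((measurable_one (α := ℝ≥0∞)).indicator hT).aemeasurable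
  have hmul : (g * T.indicator 1) = g := by
    ext x
    by_cases hx : x ∈ T
    · simp [hx]
    · simp [hx, hzero x hx]
  have hind : ∀ x, (T.indicator (1 : ℝ → ℝ≥0∞) x) ^ (2 : ℝ) = T.indicator 1 x := fun x => by
    by_cases hx : x ∈ T <;> simp [hx]
  simp_rw [hmul, hint, hind, lintegral_indicator_one hT, ENNReal.rpow_two] at hCS
  have h2 : ENNReal.ofReal (2 * r) ^ 2 ≤ (∫⁻ x, g x ^ 2) * volume T := by
    calc _ ≤ ((∫⁻ x, g x ^ 2) ^ (1 / (2 : ℝ)) * volume T ^ (1 / (2 : ℝ))) ^ 2 := by gcongr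
      _ = _ := by
        rw [mul_pow, ← ENNReal.rpow_two, ← ENNReal.rpow_two, ← ENNReal.rpow_mul,
          ← ENNReal.rpow_mul]
        norm_num
  have hpos : ENNReal.ofReal (2 * r) ≠ 0 := by simpa using hr
  refine (ENNReal.mul_le_mul_iff_right hpos ENNReal.ofReal_ne_top).1 ?_
  calc _ = ENNReal.ofReal (2 * r) ^ 2 := by rw [sq]
    _ ≤ _ := h2
    _ ≤ _ := mul_le_mul_left hsq _
    _ = _ := by ring

/-- A compact set that carries a measure `κ` has positive length if along infinitely many dyadic
scales `r` the `κ × κ`-measure of the pairs at distance at most `r` is `O(r)`. -/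
theorem volume_pos_of_liminf_ne_top (κ : Measure ℝ) [IsProbabilityMeasure κ] {A : Set ℝ}
    (hA : IsCompact A) (hκ : κ Aᶜ = 0)
    (h : liminf (fun n : ℕ => 2 ^ n * (κ.prod κ) {p | dist p.1 p.2 ≤ (1 / 2 : ℝ) ^ n}) atTop ≠ ∞) :
    0 < volume A := by
  set L := liminf (fun n : ℕ => 2 ^ n * (κ.prod κ) {p | dist p.1 p.2 ≤ (1 / 2 : ℝ) ^ n}) atTop
  have hfreq : ∃ᶠ n : ℕ in atTop,
      2 ^ n * (κ.prod κ) {p | dist p.1 p.2 ≤ (1 / 2 : ℝ) ^ n} < L + 1 :=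
    frequently_lt_of_liminf_lt (by isBoundedDefault) (ENNReal.lt_add_right h one_ne_zero)
  have hr : Tendsto (fun n : ℕ => (1 / 2 : ℝ) ^ n / 2) atTop (𝓝 0) := by
    have := tendsto_pow_atTop_nhds_zero_of_lt_one (r := (1 / 2 : ℝ)) (by norm_num) (by norm_num)
    simpa using this.div_const 2
  have hlim := (tendsto_measure_cthickening_of_isCompact (μ := volume) hA).comp hr
  have hle : (L + 1)⁻¹ ≤ volume A := by
    refine ge_of_tendsto_of_frequently hlim (hfreq.mono fun n hn => ?_)
    have key := le_volume_cthickening_mul κ hκ (r := (1 / 2 : ℝ) ^ n / 2) (by positivity)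
    rw [show 2 * ((1 / 2 : ℝ) ^ n / 2) = (1 / 2) ^ n by ring] at key
    have hp : (2 : ℝ≥0∞) ^ n * ENNReal.ofReal ((1 / 2) ^ n) = 1 := by
      rw [ENNReal.ofReal_pow (by norm_num), ← mul_pow]
      have : (2 : ℝ≥0∞) * ENNReal.ofReal (1 / 2) = 1 := by
        rw [← ENNReal.ofReal_ofNat 2, ← ENNReal.ofReal_mul (by norm_num)]
        norm_num
      rw [this, one_pow]
    rw [← mul_one (L + 1)⁻¹, ENNReal.inv_mul_le_iff (by simp) (by simp [h])]
    refine hp.symm.le.trans ?_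
    calc _ ≤ 2 ^ n * (volume (Metric.cthickening ((1 / 2 : ℝ) ^ n / 2) A) *
          (κ.prod κ) {p | dist p.1 p.2 ≤ (1 / 2 : ℝ) ^ n}) := by gcongr
      _ = (2 ^ n * (κ.prod κ) {p | dist p.1 p.2 ≤ (1 / 2 : ℝ) ^ n}) *
          volume (Metric.cthickening ((1 / 2 : ℝ) ^ n / 2) A) := by ring
      _ ≤ _ := by
        dsimp only [Function.comp_apply]
        gcongr
  exact lt_of_lt_of_le (by simp [h]) hle

/-- The energy method at dyadic scales: the hypothesis makes `κ (closedBall x (2⁻ʲ)) ≤ M 2^{-sj}` hold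
for all `j` on a set of positive measure, and the mass distribution principle applies to the
restriction of `κ` to that set. -/
theorem le_dimH_of_tsum_ne_top (κ : Measure ℝ) [IsProbabilityMeasure κ] {A : Set ℝ}
    (hκ : κ Aᶜ = 0) {s : ℝ≥0} (hs : 0 < s)
    (h : ∑' j : ℕ, ((2 : ℝ≥0∞) ^ (s : ℝ)) ^ j *
      (κ.prod κ) {p | dist p.1 p.2 ≤ (1 / 2 : ℝ) ^ j} ≠ ∞) :
    (s : ℝ≥0∞) ≤ dimH A := by
  set c : ℝ≥0∞ := (2 : ℝ≥0∞) ^ (s : ℝ) with hc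
  have hc1 : 1 < c := ENNReal.one_lt_rpow (by norm_num) (by exact_mod_cast hs)
  have hctop : c ≠ ∞ := by simp [hc]
  have hm : ∀ j : ℕ, Measurable fun x => c ^ j * κ (Metric.closedBall x ((1 / 2 : ℝ) ^ j)) :=
    fun j => (measurable_measure_closedBall κ _).const_mul _
  have hint : ∫⁻ x, ∑' j : ℕ, c ^ j * κ (Metric.closedBall x ((1 / 2 : ℝ) ^ j)) ∂κ ≠ ∞ := by
    rw [lintegral_tsum fun j => (hm j).aemeasurable]
    simp_rw [lintegral_const_mul _ (measurable_measure_closedBall κ _),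
      ← prod_dist_le_eq_lintegral]
    exact h
  have hae := ae_lt_top (Measurable.tsum hm) hint
  set F : ℕ → Set ℝ := fun M => {x | ∀ j : ℕ,
    c ^ j * κ (Metric.closedBall x ((1 / 2 : ℝ) ^ j)) ≤ M} with hF
  have hFm : ∀ M, MeasurableSet (F M) := fun M => by
    simp only [hF, ofPred_forall]
    exact MeasurableSet.iInter fun j => measurableSet_le (hm j) measurable_const
  obtain ⟨M, hM⟩ : ∃ M, κ (F M) ≠ 0 := by
    by_contra! hnull
    have h0 := measure_iUnion_null hnull
    have h1 : (⋃ M, F M) ∈ ae κ := by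
      filter_upwards [hae] with x hx
      obtain ⟨M, hM⟩ := ENNReal.exists_nat_gt hx.ne
      exact mem_iUnion.2 ⟨M, fun j => (ENNReal.le_tsum j).trans hM.le⟩
    have h2 := measure_univ (μ := κ)
    rw [← measure_add_measure_compl (MeasurableSet.iUnion hFm), h0, mem_ae_iff.1 h1] at h2
    simp at h2
  set K : ℝ≥0∞ := c * (M + 1) with hK
  have hK0 : K ≠ 0 := by simp [hK, (zero_lt_one.trans hc1).ne']
  have hKtop : K ≠ ∞ := ENNReal.mul_ne_top hctop (by simp)
  -- `S` lies in a ball around a point of `F M` of dyadic radius comparable to its diameter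
  have hmass : ∀ S : Set ℝ, Metric.ediam S ≤ 1 →
      (K⁻¹ • κ.restrict (F M)) S ≤ Metric.ediam S ^ (s : ℝ) := by
    intro S hS
    rw [Measure.smul_apply, smul_eq_mul, ENNReal.inv_mul_le_iff hK0 hKtop,
      Measure.restrict_apply' (hFm M)]
    rcases (S ∩ F M).eq_empty_or_nonempty with hemp | ⟨x, hxS, hxF⟩
    · simp [hemp]
    have hStop : Metric.ediam S ≠ ∞ := (hS.trans_lt ENNReal.one_lt_top).ne
    have hbound : ∀ j : ℕ, (Metric.ediam S).toReal ≤ (1 / 2) ^ j →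
        κ (S ∩ F M) ≤ (M + 1) * (c ^ j)⁻¹ := by
      intro j hj
      have hsub : S ∩ F M ⊆ Metric.closedBall x ((1 / 2 : ℝ) ^ j) := fun z hz =>
        (Metric.dist_le_diam_of_mem' hStop hz.1 hxS).trans hj
      rw [← div_eq_mul_inv, ENNReal.le_div_iff_mul_le (by simp [(zero_lt_one.trans hc1).ne'])
        (by simp [hctop]), mul_comm]
      calc _ ≤ c ^ j * κ (Metric.closedBall x ((1 / 2 : ℝ) ^ j)) := by gcongr
        _ ≤ M := hxF j
        _ ≤ M + 1 := le_self_add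
    rcases eq_or_ne (Metric.ediam S) 0 with hd | hd
    · have hlim : Tendsto (fun j : ℕ => ((M : ℝ≥0∞) + 1) * (c⁻¹) ^ j) atTop (𝓝 ((M + 1) * 0)) :=
        ENNReal.Tendsto.const_mul
          (ENNReal.tendsto_pow_atTop_nhds_zero_of_lt_one (ENNReal.inv_lt_one.2 hc1))
          (Or.inr (by simp))
      have : κ (S ∩ F M) ≤ (M + 1) * 0 := by
        refine ge_of_tendsto' hlim fun j => ?_
        rw [← ENNReal.inv_pow]
        exact hbound j (by rw [hd]; positivity)
      simp only [mul_zero] at this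
      exact this.trans bot_le
    · obtain ⟨j, hj1, hj2⟩ := exists_nat_pow_near_of_lt_one (ENNReal.toReal_pos hd hStop)
        (ENNReal.toReal_le_of_le_ofReal zero_le_one (by simpa using hS))
        (show (0 : ℝ) < 1 / 2 by norm_num) (by norm_num)
      refine (hbound j hj2).trans ?_
      have hle : (c ^ (j + 1))⁻¹ ≤ Metric.ediam S ^ (s : ℝ) := by
        have h1 : ((2 : ℝ≥0∞) ^ (j + 1))⁻¹ ≤ Metric.ediam S := by
          rw [← ENNReal.ofReal_toReal hStop]
          refine le_trans (le_of_eq ?_) (ENNReal.ofReal_le_ofReal hj1.le)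
          rw [ENNReal.ofReal_pow (by norm_num), one_div, ENNReal.ofReal_inv_of_pos (by norm_num),
            ENNReal.inv_pow]
          simp
        calc (c ^ (j + 1))⁻¹ = (((2 : ℝ≥0∞) ^ (j + 1))⁻¹) ^ (s : ℝ) := by
              rw [ENNReal.inv_rpow, hc, ← ENNReal.rpow_natCast, ← ENNReal.rpow_natCast,
                ← ENNReal.rpow_mul, ← ENNReal.rpow_mul, mul_comm]
          _ ≤ _ := by gcongr
      calc ((M : ℝ≥0∞) + 1) * (c ^ j)⁻¹ = K * (c ^ (j + 1))⁻¹ := by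
            rw [hK, pow_succ, ENNReal.mul_inv (Or.inr hctop) (Or.inl (by simp [hctop]))]
            rw [show c * ((M : ℝ≥0∞) + 1) * ((c ^ j)⁻¹ * c⁻¹) =
              (M + 1) * (c ^ j)⁻¹ * (c * c⁻¹) by ring,
              ENNReal.mul_inv_cancel (zero_lt_one.trans hc1).ne' hctop, mul_one]
        _ ≤ _ := by gcongr
  have hmeas := Measure.le_hausdorffMeasure (s : ℝ) _ 1 one_pos hmass A
  refine le_dimH_of_hausdorffMeasure_ne_zero fun h0 => hM ?_
  rw [h0, Measure.smul_apply, smul_eq_mul, nonpos_iff_eq_zero, mul_eq_zero,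
    Measure.restrict_apply' (hFm M)] at hmeas
  rcases hmeas with hmeas | hmeas
  · simp [hKtop] at hmeas
  · refine measure_mono_null (t := (A ∩ F M) ∪ Aᶜ) (fun x hx => ?_) (measure_union_null hmeas hκ)
    by_cases hxA : x ∈ A
    · exact Or.inl ⟨hxA, hx⟩
    · exact Or.inr hxA

/-- By Fubini, `A ∩ (t - B)` has positive measure for some `t`, so by Steinhaus' theorem its difference
set contains a neighbourhood of `0`, and `A + B` contains a neighbourhood of `t`. -/
theorem exists_Icc_subset_add {A B : Set ℝ} (hA : MeasurableSet A) (hB : MeasurableSet B)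
    (hA0 : 0 < volume A) (hB0 : 0 < volume B) :
    ∃ a b : ℝ, a < b ∧ ∀ x ∈ Icc a b, ∃ u ∈ A, ∃ v ∈ B, u + v = x := by
  have hEm : ∀ t : ℝ, MeasurableSet (A ∩ (fun x => t - x) ⁻¹' B) := fun t =>
    hA.inter ((measurable_const.sub measurable_id) hB)
  obtain ⟨t, ht⟩ : ∃ t : ℝ, 0 < volume (A ∩ (fun x => t - x) ⁻¹' B) := by
    by_contra! hnull
    have hm : Measurable fun p : ℝ × ℝ => A.indicator (1 : ℝ → ℝ≥0∞) p.2 *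
        B.indicator (1 : ℝ → ℝ≥0∞) (p.1 - p.2) :=
      ((measurable_one.indicator hA).comp measurable_snd).mul
        ((measurable_one.indicator hB).comp (measurable_fst.sub measurable_snd))
    have h1 : ∫⁻ t : ℝ, ∫⁻ x : ℝ, A.indicator (1 : ℝ → ℝ≥0∞) x *
        B.indicator (1 : ℝ → ℝ≥0∞) (t - x) = 0 := by
      refine (lintegral_congr fun t => ?_).trans lintegral_zero
      rw [← nonpos_iff_eq_zero]
      refine le_trans (le_of_eq ?_) (hnull t)
      rw [← lintegral_indicator_one (hEm t)]
      refine lintegral_congr fun x => ?_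
      by_cases hx : x ∈ A <;> by_cases hy : t - x ∈ B <;> simp [indicator, hx, hy]
    rw [lintegral_lintegral_swap hm.aemeasurable] at h1
    have h2 : ∀ x : ℝ, ∫⁻ t : ℝ, A.indicator (1 : ℝ → ℝ≥0∞) x *
        B.indicator (1 : ℝ → ℝ≥0∞) (t - x) = A.indicator 1 x * volume B := fun x => by
      have hmx : Measurable fun t => B.indicator (1 : ℝ → ℝ≥0∞) (t - x) :=
        (measurable_one.indicator hB).comp (measurable_id.sub measurable_const)
      rw [lintegral_const_mul _ hmx,
        lintegral_sub_right_eq_self (fun t => B.indicator (1 : ℝ → ℝ≥0∞) t),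
        lintegral_indicator_one hB]
    simp_rw [h2] at h1
    rw [lintegral_mul_const _ (measurable_one.indicator hA), lintegral_indicator_one hA] at h1
    exact mul_ne_zero hA0.ne' hB0.ne' h1
  obtain ⟨ε, hε, hball⟩ := Metric.mem_nhds_iff.1
    (Measure.sub_mem_nhds_zero_of_addHaar_pos volume _ (hEm t) ht)
  refine ⟨t - ε / 2, t + ε / 2, by linarith, fun x hx => ?_⟩
  have hmem : x - t ∈ Metric.ball (0 : ℝ) ε := by
    rw [Metric.mem_ball, dist_zero_right, Real.norm_eq_abs, abs_lt]
    constructor <;> linarith [hx.1, hx.2]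
  obtain ⟨e, he, e', he', hee⟩ := hball hmem
  exact ⟨e, he.1, t - e', he'.2, by simp only at hee; linarith⟩

/-! ### The coded sums -/

/-- The product `y_0 ⋯ y_{qi-1}` of the first `q * i` errors. -/
def weight (q : ℕ) (y : ℕ → ℝ) (i : ℕ) : ℝ := ∏ j ∈ Finset.range (q * i), y j

/-- The sum of the series `∑ d_{a_i} y_0 ⋯ y_{qi-1}`. It is encoded as the upper limit of the partial
sums, which is jointly measurable in `y` and `a` without any convergence assumption. -/
noncomputable def codedSum {m : ℕ} (q : ℕ) (d : Fin m → ℝ) (y : ℕ → ℝ) (a : ℕ → Fin m) : ℝ :=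
  limsup (fun n => ∑ i ∈ Finset.range n, d (a i) * weight q y i) atTop

/-- The uniform Bernoulli measure on the sequences of digits. -/
noncomputable def digitMeasure (m : ℕ) [NeZero m] : Measure (ℕ → Fin m) :=
  Measure.infinitePi fun _ => (PMF.uniformOfFintype (Fin m)).toMeasure

instance (m : ℕ) [NeZero m] : IsProbabilityMeasure (digitMeasure m) := by
  unfold digitMeasure; infer_instance

theorem measurable_weight (q i : ℕ) : Measurable fun y => weight q y i := by
  unfold weight; fun_prop

theorem Measurable.codedSum {m : ℕ} (q : ℕ) (d : Fin m → ℝ) {α : Type*} [MeasurableSpace α]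
    {f : α → ℕ → ℝ} {g : α → ℕ → Fin m} (hf : Measurable f) (hg : Measurable g) :
    Measurable fun x => codedSum q d (f x) (g x) := by
  refine Measurable.limsup fun n => Finset.measurable_sum _ fun i _ => ?_
  exact ((measurable_of_finite d).comp ((measurable_pi_apply i).comp hg)).mul
    ((measurable_weight q i).comp hf)

theorem hasSum_codedSum {m q : ℕ} (d : Fin m → ℝ) {y : ℕ → ℝ} (hy : Summable (weight q y))
    (a : ℕ → Fin m) : HasSum (fun i => d (a i) * weight q y i) (codedSum q d y a) := by
  have hs : Summable fun i => d (a i) * weight q y i := by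
    refine Summable.of_norm_bounded (hy.abs.mul_left (∑ j, |d j|)) fun i => ?_
    rw [Real.norm_eq_abs, abs_mul]
    gcongr
    exact Finset.single_le_sum (f := fun j => |d j|) (fun _ _ => abs_nonneg _) (Finset.mem_univ _)
  have := hs.hasSum
  rwa [← this.tendsto_sum_nat.limsup_eq] at this

/-! ### Transversality in one error -/

theorem weight_update_of_le {q k i : ℕ} (h : i ≤ k) (y : ℕ → ℝ) (x : ℝ) :
    weight q (Function.update y (q * k) x) i = weight q y i := by
  refine Finset.prod_congr rfl fun j hj => Function.update_of_ne ?_ _ _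
  have := Nat.mul_le_mul_left q h
  have := Finset.mem_range.1 hj
  omega

theorem weight_update_of_lt {q k i : ℕ} (hq : 0 < q) (h : k < i) (y : ℕ → ℝ) (x : ℝ) :
    weight q (Function.update y (q * k) x) i = x * weight q (Function.update y (q * k) 1) i := by
  have hmem : q * k ∈ Finset.range (q * i) := by simpa [hq] using h
  unfold weight
  rw [Finset.prod_update_of_mem hmem, Finset.prod_update_of_mem hmem, one_mul]

theorem summable_weight_update {q : ℕ} (hq : 0 < q) (k : ℕ) {y : ℕ → ℝ} (hy : Summable (weight q y))
    (hyk : y (q * k) ≠ 0) (x : ℝ) : Summable (weight q (Function.update y (q * k) x)) := by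
  rw [← summable_nat_add_iff (k + 1)] at hy ⊢
  have h1 : ∀ z i, weight q (Function.update y (q * k) z) (i + (k + 1)) =
      z * weight q (Function.update y (q * k) 1) (i + (k + 1)) :=
    fun z i => weight_update_of_lt hq (by omega) y z
  have h2 := h1 (y (q * k))
  simp only [Function.update_eq_self] at h2
  simp_rw [h2] at hy
  simp_rw [h1 x]
  exact ((summable_mul_left_iff hyk).1 hy).mul_left x

/-- When two sequences of digits first differ at `k`, the difference of their sums is affine in the
error `y_{qk}`, and its constant term `(d_{a_k} - d_{b_k}) y_0 ⋯ y_{qk-1}` is bounded away from `0`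
in terms of the product only. -/
theorem codedSum_update_sub {m q : ℕ} (hq : 0 < q) (d : Fin m → ℝ) {a b : ℕ → Fin m} {k : ℕ}
    (hab : ∀ i < k, a i = b i) {y : ℕ → ℝ} (hy : Summable (weight q y)) (hyk : y (q * k) ≠ 0) :
    ∃ V : ℝ, ∀ x, codedSum q d (Function.update y (q * k) x) a -
      codedSum q d (Function.update y (q * k) x) b = (d (a k) - d (b k)) * weight q y k + x * V := by
  refine ⟨∑' i, (d (a (i + (k + 1))) - d (b (i + (k + 1)))) *
    weight q (Function.update y (q * k) 1) (i + (k + 1)), fun x => ?_⟩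
  have hs := summable_weight_update hq k hy hyk x
  have h := (hasSum_codedSum d hs a).sub (hasSum_codedSum d hs b)
  rw [← h.tsum_eq, ← h.summable.sum_add_tsum_nat_add (k + 1), Finset.sum_range_succ,
    Finset.sum_eq_zero fun i hi => by rw [hab i (Finset.mem_range.1 hi), sub_self], zero_add,
    weight_update_of_le le_rfl, ← tsum_mul_left]
  congr 1
  · ring
  · refine tsum_congr fun i => ?_
    rw [weight_update_of_lt hq (show k < i + (k + 1) by omega)]
    ring

/-- An affine function whose constant term is at least `δρ` in absolute value is `r`-small on `(0, R]` with
probability `O(r / ρ)`: unless `r` is comparable to `ρ`, this forces the slope to be at least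
`δρ / (2R)`, and the set of such `x` is a short interval. -/
theorem measure_abs_affine_le (η : Measure ℝ) [IsProbabilityMeasure η] {K R δ ρ r : ℝ} (hK0 : 0 ≤ K)
    (hK : ∀ S, η S ≤ ENNReal.ofReal K * volume S) (hR : 0 < R) (hδ : 0 < δ) (hρ : 0 < ρ)
    (hr : 0 < r) {u V : ℝ} (hu : δ * ρ ≤ |u|) :
    η {x | (0 < x ∧ x ≤ R) ∧ |u + x * V| ≤ r} ≤
      ENNReal.ofReal ((2 + 4 * R * K) / δ * (r / ρ)) := by
  rcases le_or_gt (δ * ρ / 2) r with h | h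
  · refine prob_le_one.trans ?_
    rw [ENNReal.one_le_ofReal, div_mul_div_comm, le_div_iff₀ (by positivity)]
    nlinarith [mul_nonneg (mul_nonneg hR.le hK0) hr.le]
  · rcases eq_empty_or_nonempty {x | (0 < x ∧ x ≤ R) ∧ |u + x * V| ≤ r} with he | ⟨x₀, ⟨h0, hxR⟩, hx⟩
    · simp [he]
    have hV : δ * ρ / 2 ≤ R * |V| := by
      have h1 : |u| - |x₀ * V| ≤ |u + x₀ * V| := by
        have := abs_sub_abs_le_abs_sub u (-(x₀ * V))
        rwa [abs_neg, sub_neg_eq_add] at this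
      have h2 : |x₀ * V| ≤ R * |V| := by
        rw [abs_mul, abs_of_pos h0]
        gcongr
      linarith
    have hVpos : 0 < |V| := by
      have : 0 < R * |V| := lt_of_lt_of_le (by positivity) hV
      exact pos_of_mul_pos_right this hR.le
    have hsub : {x | (0 < x ∧ x ≤ R) ∧ |u + x * V| ≤ r} ⊆
        Metric.closedBall (-u / V) (r / |V|) := by
      rintro x ⟨-, hx⟩
      rw [Metric.mem_closedBall, Real.dist_eq, le_div_iff₀ hVpos, ← abs_mul]
      rwa [sub_mul, div_mul_cancel₀ _ (abs_pos.1 hVpos), sub_neg_eq_add, add_comm]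
    calc _ ≤ η (Metric.closedBall (-u / V) (r / |V|)) := measure_mono hsub
      _ ≤ _ := hK _
      _ = ENNReal.ofReal (K * (2 * (r / |V|))) := by
        rw [Real.volume_closedBall, ENNReal.ofReal_mul hK0]
      _ ≤ _ := by
        refine ENNReal.ofReal_le_ofReal ?_
        have h1 : r / |V| ≤ 2 * R * r / (δ * ρ) := by
          rw [div_le_div_iff₀ hVpos (by positivity)]
          nlinarith
        calc K * (2 * (r / |V|)) ≤ K * (2 * (2 * R * r / (δ * ρ))) := by gcongr
          _ = (0 + 4 * R * K) / δ * (r / ρ) := by field_simp; ring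
          _ ≤ _ := by gcongr; norm_num

theorem measure_codedSum_close_le (η : Measure ℝ) [IsProbabilityMeasure η] {K R δ ρ r : ℝ}
    (hK0 : 0 ≤ K) (hK : ∀ S, η S ≤ ENNReal.ofReal K * volume S) (hR : 0 < R)
    (hηR : ∀ᵐ x ∂η, 0 < x ∧ x ≤ R) (hδ : 0 < δ) (hρ : 0 < ρ) (hr : 0 < r) {m q : ℕ} (hq : 0 < q)
    (hsum : ∀ᵐ y ∂(Measure.infinitePi fun _ : ℕ => η), (∀ i, 0 < y i) ∧ Summable (weight q y))
    (d : Fin m → ℝ) {a b : ℕ → Fin m} {k : ℕ} (hab : ∀ i < k, a i = b i)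
    (hd : δ ≤ |d (a k) - d (b k)|) :
    Measure.infinitePi (fun _ : ℕ => η)
      {y | ρ ≤ weight q y k ∧ dist (codedSum q d y a) (codedSum q d y b) ≤ r} ≤
      ENNReal.ofReal ((2 + 4 * R * K) / δ * (r / ρ)) := by
  set μ := Measure.infinitePi fun _ : ℕ => η with hμ
  have hc : ∀ a, Measurable fun y => codedSum q d y a := fun a =>
    measurable_id.codedSum q d measurable_const
  have hE : MeasurableSet
      {y | ρ ≤ weight q y k ∧ dist (codedSum q d y a) (codedSum q d y b) ≤ r} :=
    (measurableSet_le measurable_const (measurable_weight q k)).inter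
      (measurableSet_le ((hc a).dist (hc b)) measurable_const)
  have hupd : Measurable fun p : (ℕ → ℝ) × ℝ => Function.update p.1 (q * k) p.2 := by
    refine measurable_pi_iff.2 fun i => ?_
    by_cases h : i = q * k
    · subst h; simpa using measurable_snd
    · simp only [Function.update_of_ne h]; fun_prop
  conv_lhs => rw [hμ, ← map_update_prod_infinitePi (fun _ : ℕ => η) (q * k)]
  rw [Measure.map_apply hupd hE, Measure.prod_apply (hupd hE), ← hμ]
  calc _ ≤ ∫⁻ _, ENNReal.ofReal ((2 + 4 * R * K) / δ * (r / ρ)) ∂μ := by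
        refine lintegral_mono_ae ?_
        filter_upwards [hsum] with y hy
        obtain ⟨V, hV⟩ := codedSum_update_sub hq d hab hy.2 (hy.1 _).ne'
        rcases lt_or_ge (weight q y k) ρ with hlt | hge
        · refine le_trans (le_of_eq ?_) bot_le
          refine measure_mono_null (t := ∅) ?_ measure_empty
          rintro x ⟨hx, -⟩
          simp only [weight_update_of_le le_rfl] at hx
          exact absurd hx hlt.not_ge
        · refine le_trans (measure_mono_ae ?_) (measure_abs_affine_le η hK0 hK hR hδ hρ hr
            (u := (d (a k) - d (b k)) * weight q y k) (V := V) ?_)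
          · filter_upwards [hηR] with x hx hxE
            refine ⟨hx, ?_⟩
            rw [← hV, ← Real.dist_eq]
            exact hxE.2
          · rw [abs_mul, abs_of_pos (hρ.trans_le hge)]
            gcongr
    _ = _ := by simp

/-! ### Correlation of the coded sums -/

theorem digitMeasure_cylinder (m : ℕ) [NeZero m] (a : ℕ → Fin m) (k : ℕ) :
    digitMeasure m {b | ∀ i < k, a i = b i} = ((m : ℝ≥0∞)⁻¹) ^ k := by
  have : {b : ℕ → Fin m | ∀ i < k, a i = b i} = Set.pi (Finset.range k) fun i => {a i} := by
    ext b; simp [Set.mem_pi, eq_comm]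
  rw [this, digitMeasure, Measure.infinitePi_pi _ fun i _ => measurableSet_singleton _]
  simp

theorem measurableSet_cylinder_digits {m : ℕ} (a : ℕ → Fin m) (k : ℕ) :
    MeasurableSet {b : ℕ → Fin m | ∀ i < k, a i = b i} := by
  have : {b : ℕ → Fin m | ∀ i < k, a i = b i} = Set.pi (Finset.range k) fun i => {a i} := by
    ext b; simp [Set.mem_pi, eq_comm]
  rw [this]
  exact .pi (Finset.countable_toSet _) fun i _ => measurableSet_singleton _

/-- The errors whose products `y_0 ⋯ y_{qk-1}` are all at least `e^{-lk} / N`. -/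
def slowDecay (q : ℕ) (l N : ℝ) : Set (ℕ → ℝ) := {y | ∀ k : ℕ, Real.exp (-l * k) ≤ N * weight q y k}

theorem measurableSet_slowDecay (q : ℕ) (l N : ℝ) : MeasurableSet (slowDecay q l N) := by
  simp only [slowDecay, ofPred_forall]
  exact MeasurableSet.iInter fun k =>
    measurableSet_le measurable_const ((measurable_weight q k).const_mul N)

/-- The distribution of the random sum `∑ d_{a_i} y_0 ⋯ y_{qi-1}` for given `y` and independent,
uniformly distributed digits. -/
noncomputable def codedMeasure {m : ℕ} [NeZero m] (q : ℕ) (d : Fin m → ℝ) (y : ℕ → ℝ) : Measure ℝ :=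
  (digitMeasure m).map (codedSum q d y)

theorem measurable_codedSum_right {m : ℕ} (q : ℕ) (d : Fin m → ℝ) (y : ℕ → ℝ) :
    Measurable (codedSum q d y) :=
  measurable_const.codedSum q d measurable_id

instance {m : ℕ} [NeZero m] (q : ℕ) (d : Fin m → ℝ) (y : ℕ → ℝ) :
    IsProbabilityMeasure (codedMeasure q d y) :=
  Measure.isProbabilityMeasure_map (measurable_codedSum_right q d y).aemeasurable

theorem measurableSet_codedSum_close {m : ℕ} (q : ℕ) (d : Fin m → ℝ) (r : ℝ) :
    MeasurableSet {p : (ℕ → ℝ) × (ℕ → Fin m) × (ℕ → Fin m) |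
      dist (codedSum q d p.1 p.2.1) (codedSum q d p.1 p.2.2) ≤ r} :=
  measurableSet_le ((measurable_fst.codedSum q d measurable_snd.fst).dist
    (measurable_fst.codedSum q d measurable_snd.snd)) measurable_const

theorem codedMeasure_prod_dist_le {m : ℕ} [NeZero m] (q : ℕ) (d : Fin m → ℝ) (y : ℕ → ℝ) (r : ℝ) :
    ((codedMeasure q d y).prod (codedMeasure q d y)) {p | dist p.1 p.2 ≤ r} =
      ((digitMeasure m).prod (digitMeasure m))
        {p | dist (codedSum q d y p.1) (codedSum q d y p.2) ≤ r} := by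
  have hm := measurable_codedSum_right q d y
  rw [codedMeasure, Measure.map_prod_map _ _ hm hm,
    Measure.map_apply (hm.prodMap hm) (measurableSet_dist_le r)]
  rfl

theorem measurable_codedMeasure_prod_dist_le {m : ℕ} [NeZero m] (q : ℕ) (d : Fin m → ℝ) (r : ℝ) :
    Measurable fun y =>
      ((codedMeasure q d y).prod (codedMeasure q d y)) {p | dist p.1 p.2 ≤ r} := by
  simp_rw [codedMeasure_prod_dist_le]
  exact measurable_measure_prodMk_left (measurableSet_codedSum_close q d r)

/-- On average over slowly decaying `y`, the pairs of digit sequences whose sums are within `r` have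
measure `O(r^s)`. Pairs that first differ at `k` have measure at most `m^{-k}`, and for each of them the
sums are close with probability at most `min(1, O(r e^{lk})) ≤ O(r^s e^{slk})`; the sum over `k` is a
convergent geometric series because `s * l < log m`. -/
theorem exists_lintegral_overlap_le (η : Measure ℝ) [IsProbabilityMeasure η] {K R : ℝ}
    (hK0 : 0 ≤ K) (hK : ∀ S, η S ≤ ENNReal.ofReal K * volume S) (hR : 0 < R)
    (hηR : ∀ᵐ x ∂η, 0 < x ∧ x ≤ R) {m q : ℕ} [NeZero m] (hq : 0 < q)
    (hsum : ∀ᵐ y ∂(Measure.infinitePi fun _ : ℕ => η), (∀ i, 0 < y i) ∧ Summable (weight q y))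
    {d : Fin m → ℝ} (hd : Function.Injective d) {s l N : ℝ} (hs0 : 0 ≤ s) (hs1 : s ≤ 1)
    (hl : 0 ≤ l) (hN : 0 < N) (hm : s * l < Real.log m) :
    ∃ C : ℝ≥0∞, C ≠ ∞ ∧ ∀ r : ℝ, 0 < r →
      ∫⁻ y in slowDecay q l N,
        ((codedMeasure q d y).prod (codedMeasure q d y)) {p | dist p.1 p.2 ≤ r}
          ∂(Measure.infinitePi fun _ : ℕ => η) ≤ C * ENNReal.ofReal (r ^ s) := by
  set μ := Measure.infinitePi fun _ : ℕ => η with hμ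
  obtain ⟨δ, hδ, hdδ⟩ : ∃ δ > 0, ∀ i j, i ≠ j → δ ≤ |d i - d j| := by
    have hfin := Set.finite_range fun p : {p : Fin m × Fin m // p.1 ≠ p.2} => |d p.1.1 - d p.1.2|
    have h0 : ∀ᶠ δ in 𝓝[>] (0 : ℝ),
        ∀ p : {p : Fin m × Fin m // p.1 ≠ p.2}, δ ≤ |d p.1.1 - d p.1.2| := by
      refine eventually_all.2 fun p => ?_
      have : 0 < |d p.1.1 - d p.1.2| := abs_pos.2 (sub_ne_zero.2 fun h => p.2 (hd h))
      exact (eventually_le_nhds this).filter_mono nhdsWithin_le_nhds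
    obtain ⟨δ, h1, h2⟩ := (h0.and self_mem_nhdsWithin).exists
    exact ⟨δ, h2, fun i j hij => h1 ⟨(i, j), hij⟩⟩
  set C₀ : ℝ := (2 + 4 * R * K) / δ with hC₀
  have hC₀pos : 0 < C₀ := by positivity
  have hm0 : 0 < (m : ℝ) := by exact_mod_cast NeZero.pos m
  set θ : ℝ≥0∞ := ENNReal.ofReal (Real.exp (s * l)) * (m : ℝ≥0∞)⁻¹ with hθ
  have hθ1 : θ < 1 := by
    rw [hθ, ← div_eq_mul_inv]
    refine ENNReal.div_lt_of_lt_mul ?_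
    rw [one_mul, ← ENNReal.ofReal_natCast]
    exact (ENNReal.ofReal_lt_ofReal_iff hm0).2 ((Real.lt_log_iff_exp_lt hm0).1 hm)
  refine ⟨ENNReal.ofReal ((C₀ * N) ^ s) * ∑' k, θ ^ k, ENNReal.mul_ne_top ENNReal.ofReal_ne_top ?_,
    fun r hr => ?_⟩
  · rw [ENNReal.tsum_geometric]
    simpa [tsub_eq_zero_iff_le] using hθ1
  -- the bound for two given sequences of digits
  have hpair : ∀ a b : ℕ → Fin m, (μ.restrict (slowDecay q l N))
      {y | dist (codedSum q d y a) (codedSum q d y b) ≤ r} ≤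
      ∑' k : ℕ, {b : ℕ → Fin m | ∀ i < k, a i = b i}.indicator
        (fun _ => ENNReal.ofReal ((C₀ * N * r) ^ s * Real.exp (s * l) ^ k)) b := by
    intro a b
    by_cases hab : a = b
    -- on the diagonal every term of the series is at least a positive constant
    · subst hab
      refine le_top.trans (top_le_iff.2 ?_).ge
      refine top_unique ?_
      rw [← ENNReal.tsum_const_eq_top_of_ne_zero (α := ℕ)
        (c := ENNReal.ofReal ((C₀ * N * r) ^ s)) (by simp; positivity)]
      refine ENNReal.tsum_le_tsum fun k => ?_
      rw [indicator_of_mem (by simp)]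
      refine ENNReal.ofReal_le_ofReal ?_
      exact le_mul_of_one_le_right (by positivity)
        (one_le_pow₀ (Real.one_le_exp (by positivity)))
    · have hex : ∃ k, a k ≠ b k := Function.ne_iff.1 hab
      classical
      set k := Nat.find hex with hk
      have hk1 : a k ≠ b k := Nat.find_spec hex
      have hk2 : ∀ i < k, a i = b i := fun i hi => by simpa using Nat.find_min hex hi
      refine le_trans ?_ (ENNReal.le_tsum k)
      rw [indicator_of_mem (by exact hk2)]
      set t : ℝ := C₀ * (r / (Real.exp (-l * k) / N)) with ht
      have htpos : 0 < t := by positivity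
      have hts : (C₀ * N * r) ^ s * Real.exp (s * l) ^ k = t ^ s := by
        rw [ht, show C₀ * (r / (Real.exp (-l * k) / N)) = (C₀ * N * r) * Real.exp (l * k) by
          rw [neg_mul, Real.exp_neg]; field_simp,
          Real.mul_rpow (x := C₀ * N * r) (by positivity) (by positivity),
          ← Real.exp_mul, ← Real.exp_nat_mul]
        congr 2
        ring
      rw [hts, Measure.restrict_apply' (measurableSet_slowDecay q l N)]
      rcases le_or_gt 1 t with h1 | h1
      · refine prob_le_one.trans ?_
        rw [ENNReal.one_le_ofReal]
        exact Real.one_le_rpow h1 hs0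
      · calc _ ≤ μ {y | Real.exp (-l * k) / N ≤ weight q y k ∧
              dist (codedSum q d y a) (codedSum q d y b) ≤ r} := by
              refine measure_mono fun y hy => ⟨?_, hy.1⟩
              rw [div_le_iff₀' hN]
              exact hy.2 k
          _ ≤ ENNReal.ofReal t := measure_codedSum_close_le η hK0 hK hR hηR hδ (by positivity) hr hq
              hsum d hk2 (hdδ _ _ hk1)
          _ ≤ _ := by
              refine ENNReal.ofReal_le_ofReal ?_
              simpa using Real.rpow_le_rpow_of_exponent_ge htpos h1.le hs1
  have hS := measurableSet_codedSum_close q d r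
  calc _ = ∫⁻ y in slowDecay q l N, ((digitMeasure m).prod (digitMeasure m))
        (Prod.mk y ⁻¹' {p : (ℕ → ℝ) × (ℕ → Fin m) × (ℕ → Fin m) |
          dist (codedSum q d p.1 p.2.1) (codedSum q d p.1 p.2.2) ≤ r}) ∂μ := by
        simp_rw [codedMeasure_prod_dist_le]
        rfl
    _ = ∫⁻ p, (μ.restrict (slowDecay q l N))
          {y | dist (codedSum q d y p.1) (codedSum q d y p.2) ≤ r}
          ∂((digitMeasure m).prod (digitMeasure m)) := by
        rw [← Measure.prod_apply hS, Measure.prod_apply_symm hS]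
        rfl
    _ = ∫⁻ a, ∫⁻ b, (μ.restrict (slowDecay q l N))
          {y | dist (codedSum q d y a) (codedSum q d y b) ≤ r} ∂(digitMeasure m)
          ∂(digitMeasure m) :=
        lintegral_prod _ (measurable_measure_prodMk_right hS).aemeasurable
    _ ≤ ∫⁻ a, ∫⁻ b, ∑' k : ℕ, {b : ℕ → Fin m | ∀ i < k, a i = b i}.indicator
        (fun _ => ENNReal.ofReal ((C₀ * N * r) ^ s * Real.exp (s * l) ^ k)) b ∂(digitMeasure m)
          ∂(digitMeasure m) := lintegral_mono fun a => lintegral_mono fun b => hpair a b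
    _ = ∫⁻ a : ℕ → Fin m, ∑' k : ℕ, ENNReal.ofReal ((C₀ * N * r) ^ s) * θ ^ k
          ∂(digitMeasure m) := by
        refine lintegral_congr fun a => ?_
        rw [lintegral_tsum fun k =>
          (measurable_const.indicator (measurableSet_cylinder_digits a k)).aemeasurable]
        refine tsum_congr fun k => ?_
        rw [lintegral_indicator_const (measurableSet_cylinder_digits a k), digitMeasure_cylinder,
          ENNReal.ofReal_mul (by positivity), ENNReal.ofReal_pow (by positivity), hθ, mul_pow,
          mul_assoc]
    _ = _ := by
        rw [lintegral_const, measure_univ, mul_one, ENNReal.tsum_mul_left,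
          Real.mul_rpow (by positivity) hr.le, ENNReal.ofReal_mul (by positivity)]
        ring

/-! ### Length and dimension of the set of coded sums -/

theorem continuous_codedSum {m q : ℕ} (d : Fin m → ℝ) {y : ℕ → ℝ} (hy : Summable (weight q y)) :
    Continuous (codedSum q d y) := by
  have h : codedSum q d y = fun a => ∑' i, d (a i) * weight q y i := by
    ext a
    exact (hasSum_codedSum d hy a).tsum_eq.symm
  rw [h]
  refine continuous_tsum (fun i => ?_) (hy.abs.mul_left (∑ j, |d j|)) fun i a => ?_
  · exact (continuous_of_discreteTopology.comp (continuous_apply i)).mul continuous_const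
  · rw [Real.norm_eq_abs, abs_mul]
    gcongr
    exact Finset.single_le_sum (f := fun j => |d j|) (fun _ _ => abs_nonneg _) (Finset.mem_univ _)

theorem isCompact_range_codedSum {m q : ℕ} (d : Fin m → ℝ) {y : ℕ → ℝ}
    (hy : Summable (weight q y)) : IsCompact (range (codedSum q d y)) :=
  isCompact_range (continuous_codedSum d hy)

theorem codedMeasure_compl_range {m q : ℕ} [NeZero m] (d : Fin m → ℝ) {y : ℕ → ℝ}
    (hy : Summable (weight q y)) : codedMeasure q d y (range (codedSum q d y))ᶜ = 0 := by
  rw [codedMeasure, Measure.map_apply (measurable_codedSum_right q d y)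
    (isCompact_range_codedSum d hy).measurableSet.compl]
  simp

theorem ae_volume_range_codedSum_pos (η : Measure ℝ) [IsProbabilityMeasure η] {K R : ℝ}
    (hK0 : 0 ≤ K) (hK : ∀ S, η S ≤ ENNReal.ofReal K * volume S) (hR : 0 < R)
    (hηR : ∀ᵐ x ∂η, 0 < x ∧ x ≤ R) {m q : ℕ} [NeZero m] (hq : 0 < q)
    (hsum : ∀ᵐ y ∂(Measure.infinitePi fun _ : ℕ => η), (∀ i, 0 < y i) ∧ Summable (weight q y))
    {d : Fin m → ℝ} (hd : Function.Injective d) {l : ℝ} (hl : 0 ≤ l) (hm : l < Real.log m)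
    (hdecay : ∀ᵐ y ∂(Measure.infinitePi fun _ : ℕ => η), ∃ N : ℕ, y ∈ slowDecay q l (N + 1)) :
    ∀ᵐ y ∂(Measure.infinitePi fun _ : ℕ => η), 0 < volume (range (codedSum q d y)) := by
  set μ := Measure.infinitePi fun _ : ℕ => η
  have hN : ∀ N : ℕ, ∀ᵐ y ∂μ, y ∈ slowDecay q l (N + 1) →
      liminf (fun n : ℕ => 2 ^ n * ((codedMeasure q d y).prod (codedMeasure q d y))
        {p | dist p.1 p.2 ≤ (1 / 2 : ℝ) ^ n}) atTop < ∞ := by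
    intro N
    rw [← ae_restrict_iff' (measurableSet_slowDecay q l _)]
    obtain ⟨C, hC, hCle⟩ := exists_lintegral_overlap_le η hK0 hK hR hηR hq hsum hd zero_le_one
      le_rfl hl (N.cast_add_one_pos (α := ℝ)) (by rwa [one_mul])
    have hmeas : ∀ n : ℕ, Measurable fun y => (2 : ℝ≥0∞) ^ n *
        ((codedMeasure q d y).prod (codedMeasure q d y)) {p | dist p.1 p.2 ≤ (1 / 2 : ℝ) ^ n} :=
      fun n => (measurable_codedMeasure_prod_dist_le q d _).const_mul _
    refine ae_lt_top (Measurable.liminf hmeas) (ne_top_of_le_ne_top hC ?_)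
    refine (lintegral_liminf_le hmeas).trans ?_
    refine liminf_le_of_frequently_le' (Frequently.of_forall fun n => ?_)
    rw [lintegral_const_mul _ (measurable_codedMeasure_prod_dist_le q d _)]
    calc _ ≤ 2 ^ n * (C * ENNReal.ofReal (((1 / 2 : ℝ) ^ n) ^ (1 : ℝ))) := by
          gcongr
          exact hCle _ (by positivity)
      _ = C * (2 * ENNReal.ofReal (1 / 2)) ^ n := by
          rw [Real.rpow_one, ENNReal.ofReal_pow (by norm_num), mul_pow]
          ring
      _ = C := by
          rw [← ENNReal.ofReal_ofNat 2, ← ENNReal.ofReal_mul (by norm_num)]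
          norm_num
  filter_upwards [ae_all_iff.2 hN, hsum, hdecay] with y hy hys ⟨N, hyN⟩
  exact volume_pos_of_liminf_ne_top (codedMeasure q d y) (isCompact_range_codedSum d hys.2)
    (codedMeasure_compl_range d hys.2) (hy N hyN).ne

theorem ae_le_dimH_range_codedSum (η : Measure ℝ) [IsProbabilityMeasure η] {K R : ℝ}
    (hK0 : 0 ≤ K) (hK : ∀ S, η S ≤ ENNReal.ofReal K * volume S) (hR : 0 < R)
    (hηR : ∀ᵐ x ∂η, 0 < x ∧ x ≤ R) {m q : ℕ} [NeZero m] (hq : 0 < q)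
    (hsum : ∀ᵐ y ∂(Measure.infinitePi fun _ : ℕ => η), (∀ i, 0 < y i) ∧ Summable (weight q y))
    {d : Fin m → ℝ} (hd : Function.Injective d) {t : ℝ≥0} (ht0 : 0 < t) (ht1 : t < 1) {l : ℝ}
    (hl : 0 ≤ l) (hm : t * l < Real.log m)
    (hdecay : ∀ᵐ y ∂(Measure.infinitePi fun _ : ℕ => η), ∃ N : ℕ, y ∈ slowDecay q l (N + 1)) :
    ∀ᵐ y ∂(Measure.infinitePi fun _ : ℕ => η), (t : ℝ≥0∞) ≤ dimH (range (codedSum q d y)) := by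
  set μ := Measure.infinitePi fun _ : ℕ => η
  obtain ⟨s, ⟨hs, hs1⟩, hts⟩ : ∃ s : ℝ, (s * l < Real.log m ∧ s < 1) ∧ (t : ℝ) < s := by
    have h1 : ∀ᶠ s in 𝓝 (t : ℝ), s * l < Real.log m :=
      (continuous_id.mul continuous_const).continuousAt.eventually_lt continuousAt_const hm
    have h2 : ∀ᶠ s in 𝓝 (t : ℝ), s < 1 := eventually_lt_nhds (by exact_mod_cast ht1)
    exact (((h1.and h2).filter_mono nhdsWithin_le_nhds).and
      (self_mem_nhdsWithin (s := Ioi (t : ℝ)))).exists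
  have hN : ∀ N : ℕ, ∀ᵐ y ∂μ, y ∈ slowDecay q l (N + 1) →
      ∑' j : ℕ, ((2 : ℝ≥0∞) ^ (t : ℝ)) ^ j * ((codedMeasure q d y).prod (codedMeasure q d y))
        {p | dist p.1 p.2 ≤ (1 / 2 : ℝ) ^ j} < ∞ := by
    intro N
    rw [← ae_restrict_iff' (measurableSet_slowDecay q l _)]
    obtain ⟨C, hC, hCle⟩ := exists_lintegral_overlap_le η hK0 hK hR hηR hq hsum hd
      (t.coe_nonneg.trans hts.le) hs1.le hl (N.cast_add_one_pos (α := ℝ)) hs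
    have hmeas : ∀ j : ℕ, Measurable fun y => ((2 : ℝ≥0∞) ^ (t : ℝ)) ^ j *
        ((codedMeasure q d y).prod (codedMeasure q d y)) {p | dist p.1 p.2 ≤ (1 / 2 : ℝ) ^ j} :=
      fun j => (measurable_codedMeasure_prod_dist_le q d _).const_mul _
    refine ae_lt_top (Measurable.tsum hmeas) ?_
    rw [lintegral_tsum fun j => (hmeas j).aemeasurable]
    set θ : ℝ≥0∞ := ENNReal.ofReal (2 ^ ((t : ℝ) - s)) with hθ
    have hθ1 : θ < 1 := by
      rw [hθ, ENNReal.ofReal_lt_one]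
      exact Real.rpow_lt_one_of_one_lt_of_neg one_lt_two (by linarith)
    refine ne_top_of_le_ne_top (b := C * ∑' j : ℕ, θ ^ j) (ENNReal.mul_ne_top hC ?_) ?_
    · rw [ENNReal.tsum_geometric]
      simpa [tsub_eq_zero_iff_le] using hθ1
    rw [← ENNReal.tsum_mul_left]
    refine ENNReal.tsum_le_tsum fun j => ?_
    rw [lintegral_const_mul _ (measurable_codedMeasure_prod_dist_le q d _)]
    calc _ ≤ ((2 : ℝ≥0∞) ^ (t : ℝ)) ^ j * (C * ENNReal.ofReal (((1 / 2 : ℝ) ^ j) ^ s)) := by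
          gcongr
          exact hCle _ (by positivity)
      _ = C * θ ^ j := by
          have h2 : (2 : ℝ≥0∞) ^ (t : ℝ) = ENNReal.ofReal (2 ^ (t : ℝ)) := by
            rw [← ENNReal.ofReal_rpow_of_pos two_pos, ENNReal.ofReal_ofNat]
          rw [h2, hθ, ← ENNReal.ofReal_pow (by positivity), ← ENNReal.ofReal_pow (by positivity),
            mul_left_comm, ← ENNReal.ofReal_mul (by positivity)]
          congr 2
          rw [sub_eq_add_neg, Real.rpow_add two_pos, mul_pow, Real.rpow_neg two_pos.le,
            ← Real.inv_rpow two_pos.le, one_div, ← Real.rpow_natCast, ← Real.rpow_natCast,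
            ← Real.rpow_natCast, ← Real.rpow_mul (by positivity), ← Real.rpow_mul (by positivity),
            ← Real.rpow_mul (by positivity), mul_comm (j : ℝ) s]
  filter_upwards [ae_all_iff.2 hN, hsum, hdecay] with y hy hys ⟨N, hyN⟩
  exact le_dimH_of_tsum_ne_top (codedMeasure q d y) (codedMeasure_compl_range d hys.2) ht0
    (hy N hyN).ne

/-- The natural cover: the `m^n` sets of sums with prescribed first `n` digits have diameter
`O(e^{-ln})`. -/
theorem dimH_range_codedSum_le {m : ℕ} [NeZero m] (d : Fin m → ℝ) {y : ℕ → ℝ} {C l : ℝ}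
    (hl : 0 < l) (hy : ∀ n : ℕ, |weight 1 y n| ≤ C * Real.exp (-l * n)) {t : ℝ≥0}
    (ht : Real.log m < t * l) : dimH (range (codedSum 1 d y)) ≤ t := by
  have hC : 0 ≤ C := by simpa using (abs_nonneg _).trans (hy 0)
  have hm0 : (0 : ℝ) < m := by exact_mod_cast NeZero.pos m
  set e : ℝ := Real.exp (-l) with he
  have he0 : 0 < e := Real.exp_pos _
  have he1 : e < 1 := by rw [he]; simpa using hl
  have hy' : ∀ n : ℕ, |weight 1 y n| ≤ C * e ^ n := fun n => by
    rw [he, ← Real.exp_nat_mul, mul_comm (n : ℝ)]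
    exact hy n
  have hsum : Summable (weight 1 y) :=
    Summable.of_norm_bounded ((summable_geometric_of_lt_one he0.le he1).mul_left C) hy'
  set D : ℝ := ∑ j, |d j| with hD
  have hD0 : 0 ≤ D := Finset.sum_nonneg fun _ _ => abs_nonneg _
  have hdD : ∀ j, |d j| ≤ D := fun j =>
    Finset.single_le_sum (f := fun j => |d j|) (fun _ _ => abs_nonneg _) (Finset.mem_univ _)
  set B : ℝ := 2 * D * C * (1 - e)⁻¹ with hB
  have hB0 : 0 ≤ B := by
    have : 0 < 1 - e := by linarith
    positivity
  -- sequences with the same first `n` digits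
  have hdist : ∀ (n : ℕ) (a b : ℕ → Fin m), (∀ i < n, a i = b i) →
      dist (codedSum 1 d y a) (codedSum 1 d y b) ≤ B * e ^ n := by
    intro n a b hab
    have h := (hasSum_nat_add_iff' n).2 ((hasSum_codedSum d hsum a).sub (hasSum_codedSum d hsum b))
    rw [Finset.sum_eq_zero fun i hi => by rw [hab i (Finset.mem_range.1 hi), sub_self],
      sub_zero] at h
    have hg : HasSum (fun i : ℕ => 2 * D * C * e ^ n * e ^ i) (2 * D * C * e ^ n * (1 - e)⁻¹) :=
      (hasSum_geometric_of_lt_one he0.le he1).mul_left _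
    rw [Real.dist_eq, ← Real.norm_eq_abs, hB,
      show 2 * D * C * (1 - e)⁻¹ * e ^ n = 2 * D * C * e ^ n * (1 - e)⁻¹ by ring, ← h.tsum_eq]
    refine tsum_of_norm_bounded hg fun i => ?_
    rw [← sub_mul, Real.norm_eq_abs, abs_mul]
    calc _ ≤ (D + D) * (C * e ^ (i + n)) := by
          gcongr
          · exact (abs_sub _ _).trans (add_le_add (hdD _) (hdD _))
          · exact hy' _
      _ = _ := by ring
  have hpow := tendsto_pow_atTop_nhds_zero_of_lt_one he0.le he1
  have hr : Tendsto (fun n : ℕ => ENNReal.ofReal (B * e ^ n)) atTop (𝓝 0) := by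
    simpa using ENNReal.tendsto_ofReal (hpow.const_mul B)
  have hdiam : ∀ (n : ℕ) (w : Fin n → Fin m),
      Metric.ediam (codedSum 1 d y '' {a | ∀ i : Fin n, a i = w i}) ≤ ENNReal.ofReal (B * e ^ n) := by
    intro n w
    refine Metric.ediam_le ?_
    rintro _ ⟨a, ha, rfl⟩ _ ⟨b, hb, rfl⟩
    rw [edist_dist]
    exact ENNReal.ofReal_le_ofReal
      (hdist n a b fun i hi => (ha ⟨i, hi⟩).trans (hb ⟨i, hi⟩).symm)
  have hcover : ∀ n : ℕ, range (codedSum 1 d y) ⊆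
      ⋃ w : Fin n → Fin m, codedSum 1 d y '' {a | ∀ i : Fin n, a i = w i} := by
    rintro n _ ⟨a, rfl⟩
    exact mem_iUnion.2 ⟨fun i => a i, a, fun i => rfl, rfl⟩
  have hH := Measure.hausdorffMeasure_le_liminf_sum (t : ℝ) (range (codedSum 1 d y)) _ hr _
    (Eventually.of_forall hdiam) (Eventually.of_forall hcover)
  refine dimH_le_of_hausdorffMeasure_ne_top
    (ne_top_of_le_ne_top (b := ENNReal.ofReal (B ^ (t : ℝ))) ENNReal.ofReal_ne_top (hH.trans ?_))
  have hratio : m * e ^ (t : ℝ) ≤ 1 := by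
    rw [he, ← Real.exp_mul, ← Real.exp_log hm0, ← Real.exp_add, Real.exp_le_one_iff]
    linarith
  refine liminf_le_of_frequently_le' (Frequently.of_forall fun n => ?_)
  calc _ ≤ ∑ _w : Fin n → Fin m, ENNReal.ofReal (B * e ^ n) ^ (t : ℝ) := by
        gcongr with w
        exact hdiam n w
    _ = ENNReal.ofReal (B ^ (t : ℝ) * (m * e ^ (t : ℝ)) ^ n) := by
        rw [Finset.sum_const, Finset.card_univ, Fintype.card_fun, Fintype.card_fin,
          Fintype.card_fin, nsmul_eq_mul, ENNReal.ofReal_rpow_of_nonneg (by positivity) (by simp),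
          Real.mul_rpow hB0 (by positivity), ← ENNReal.ofReal_natCast,
          ← ENNReal.ofReal_mul (by positivity)]
        congr 1
        rw [mul_pow, ← Real.rpow_natCast, ← Real.rpow_mul he0.le, ← Real.rpow_natCast (e ^ (t : ℝ)),
          ← Real.rpow_mul he0.le, mul_comm (n : ℝ)]
        push_cast
        ring
    _ ≤ ENNReal.ofReal (B ^ (t : ℝ)) := by
        refine ENNReal.ofReal_le_ofReal (mul_le_of_le_one_right (by positivity) ?_)
        exact pow_le_one₀ (by positivity) hratio

/-! ### Growth of the products -/

theorem ae_tendsto_average_log (η : Measure ℝ) [IsProbabilityMeasure η]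
    (hint : Integrable Real.log η) : ∀ᵐ y ∂(Measure.infinitePi fun _ : ℕ => η),
      Tendsto (fun n : ℕ => (∑ i ∈ Finset.range n, Real.log (y i)) / n) atTop
        (𝓝 (lyapunovExponent η)) := by
  have hmp : ∀ i, MeasurePreserving (Function.eval i) (Measure.infinitePi fun _ : ℕ => η) η :=
    measurePreserving_eval_infinitePi fun _ : ℕ => η
  have hident : ∀ i, ProbabilityTheory.IdentDistrib (fun y : ℕ → ℝ => Real.log (y i))
      (fun y => Real.log (y 0)) (Measure.infinitePi fun _ : ℕ => η)
      (Measure.infinitePi fun _ : ℕ => η) := fun i => by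
    have h : ProbabilityTheory.IdentDistrib (Function.eval i) (Function.eval 0)
        (Measure.infinitePi fun _ : ℕ => η) (Measure.infinitePi fun _ : ℕ => η) :=
      ⟨(measurable_pi_apply i).aemeasurable, (measurable_pi_apply 0).aemeasurable,
        (hmp i).map_eq.trans (hmp 0).map_eq.symm⟩
    exact h.comp Real.measurable_log
  have hindep := ProbabilityTheory.iIndepFun_infinitePi (P := fun _ : ℕ => η)
    (X := fun _ => Real.log) fun _ => Real.measurable_log
  have := ProbabilityTheory.strong_law_ae_real (fun i (y : ℕ → ℝ) => Real.log (y i))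
    ((hmp 0).integrable_comp_of_integrable hint) (fun i j hij => hindep.indepFun hij) hident
  have hmean : ∫ y, Real.log (y 0) ∂(Measure.infinitePi fun _ : ℕ => η) = lyapunovExponent η := by
    conv_rhs => rw [lyapunovExponent, ← (hmp 0).map_eq]
    rw [integral_map (hmp 0).measurable.aemeasurable Real.measurable_log.aestronglyMeasurable]
  simpa only [hmean] using this

theorem weight_eq_exp {q : ℕ} {y : ℕ → ℝ} (hy : ∀ i, 0 < y i) (n : ℕ) :
    weight q y n = Real.exp (∑ i ∈ Finset.range (q * n), Real.log (y i)) := by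
  rw [Real.exp_sum]
  exact Finset.prod_congr rfl fun i _ => (Real.exp_log (hy i)).symm

theorem exists_forall_le_of_eventually_le {f : ℕ → ℝ} (hf : ∀ᶠ n in atTop, f n ≤ 0) :
    ∃ C : ℝ, ∀ n, f n ≤ C := by
  have hbdd : IsBoundedUnder (· ≤ ·) atTop f := ⟨0, eventually_map.2 hf⟩
  obtain ⟨C, hC⟩ := hbdd.bddAbove_range
  exact ⟨C, fun n => hC ⟨n, rfl⟩⟩

theorem exists_weight_le {y : ℕ → ℝ} (hy : ∀ i, 0 < y i) {χ l : ℝ}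
    (hlim : Tendsto (fun n : ℕ => (∑ i ∈ Finset.range n, Real.log (y i)) / n) atTop (𝓝 χ))
    (hl : χ < -l) : ∃ C : ℝ, ∀ n : ℕ, |weight 1 y n| ≤ C * Real.exp (-l * n) := by
  obtain ⟨C, hC⟩ := exists_forall_le_of_eventually_le
    (f := fun n : ℕ => ∑ i ∈ Finset.range n, Real.log (y i) + l * n) (by
      filter_upwards [hlim.eventually_lt_const hl, eventually_gt_atTop 0] with n hn hn0
      rw [div_lt_iff₀ (by exact_mod_cast hn0)] at hn
      linarith)
  refine ⟨Real.exp C, fun n => ?_⟩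
  rw [weight_eq_exp hy, abs_of_pos (Real.exp_pos _), ← Real.exp_add, one_mul, Real.exp_le_exp]
  linarith [hC n]

theorem exists_mem_slowDecay {q : ℕ} {y : ℕ → ℝ} (hy : ∀ i, 0 < y i) {χ l : ℝ}
    (hlim : Tendsto (fun n : ℕ => (∑ i ∈ Finset.range n, Real.log (y i)) / n) atTop (𝓝 χ))
    (hl : -l < χ) : ∃ N : ℕ, y ∈ slowDecay q (q * l) (N + 1) := by
  obtain ⟨C, hC⟩ := exists_forall_le_of_eventually_le
    (f := fun n : ℕ => -l * n - ∑ i ∈ Finset.range n, Real.log (y i)) (by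
      filter_upwards [hlim.eventually_const_lt hl, eventually_gt_atTop 0] with n hn hn0
      rw [lt_div_iff₀ (by exact_mod_cast hn0)] at hn
      linarith)
  obtain ⟨N, hN⟩ := exists_nat_gt (Real.exp C)
  refine ⟨N, fun k => ?_⟩
  have h := hC (q * k)
  push_cast at h
  calc Real.exp (-(q * l) * k) ≤ Real.exp C * weight q y k := by
        rw [weight_eq_exp hy, ← Real.exp_add, Real.exp_le_exp]
        linarith
    _ ≤ _ := by
        have : 0 < weight q y k := Finset.prod_pos fun i _ => hy i
        gcongr
        linarith

theorem summable_weight {q : ℕ} (hq : 0 < q) {y : ℕ → ℝ} (hy : ∀ i, 0 < y i) {χ : ℝ} (hχ : χ < 0)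
    (hlim : Tendsto (fun n : ℕ => (∑ i ∈ Finset.range n, Real.log (y i)) / n) atTop (𝓝 χ)) :
    Summable (weight q y) := by
  obtain ⟨C, hC⟩ := exists_weight_le hy hlim (l := -χ / 2) (by linarith)
  have h1 : Summable (weight 1 y) := by
    refine Summable.of_norm_bounded
      ((summable_geometric_of_lt_one (Real.exp_pos (χ / 2)).le ?_).mul_left C) fun n => ?_
    · simpa using by linarith
    · refine (hC n).trans_eq ?_
      rw [← Real.exp_nat_mul]
      ring_nf
  have h2 : weight q y = weight 1 y ∘ fun i => q * i := by
    ext i; simp [weight]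
  rw [h2]
  exact h1.comp_injective fun i j h => Nat.eq_of_mul_eq_mul_left hq h

/-! ### The sets `S(y)` -/

theorem seriesTerm_eq {m : ℕ} (d : Fin m → ℝ) (y : ℕ → ℝ) (a : ℕ → Fin m) :
    seriesTerm d y a = fun i => d (a i) * weight 1 y i := by
  ext i; simp [seriesTerm, weight]

theorem sumSet_eq_range_codedSum {m : ℕ} (d : Fin m → ℝ) {y : ℕ → ℝ} (hy : Summable (weight 1 y)) :
    sumSet d y = range (codedSum 1 d y) := by
  ext x
  simp only [sumSet, mem_ofPred_eq, mem_range, seriesTerm_eq]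
  exact exists_congr fun a =>
    ⟨fun hx => (hasSum_codedSum d hy a).unique hx, fun hx => hx ▸ hasSum_codedSum d hy a⟩

/-- Splitting the digits into those at even and those at odd positions writes `S(y)` as a sum of two
sets of the same kind, in which each step multiplies by a pair of consecutive errors. -/
theorem add_mem_sumSet {m : ℕ} (d : Fin m → ℝ) {y : ℕ → ℝ} (hy : Summable (weight 2 y))
    (hy' : Summable (weight 2 fun j => y (j + 1))) (a b : ℕ → Fin m) :
    codedSum 2 d y a + y 0 * codedSum 2 d (fun j => y (j + 1)) b ∈ sumSet d y := by
  refine ⟨fun i => if Even i then a (i / 2) else b (i / 2), HasSum.even_add_odd ?_ ?_⟩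
  · convert hasSum_codedSum d hy a using 2 with i
    simp [seriesTerm, weight]
  · have h : (fun i => seriesTerm d y (fun i => if Even i then a (i / 2) else b (i / 2)) (2 * i + 1)) =
        fun i => y 0 * (d (b i) * weight 2 (fun j => y (j + 1)) i) := by
      ext i
      simp only [seriesTerm, Finset.prod_range_succ', weight]
      rw [if_neg (by simp), show (2 * i + 1) / 2 = i by omega]
      ring
    rw [h]
    exact (hasSum_codedSum d hy' b).mul_left (y 0)

/-- A density of bounded variation is bounded. -/
theorem HasBVDensity.exists_measure_le {η : Measure ℝ} (h : HasBVDensity η) :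
    ∃ K : ℝ, 0 ≤ K ∧ ∀ S, η S ≤ ENNReal.ofReal K * volume S := by
  obtain ⟨f, hf0, hbv, rfl⟩ := h
  set K := f 0 + (eVariationOn f univ).toReal
  have hfK : ∀ x, f x ≤ K := fun x => by
    have := (le_abs_self _).trans (hbv.dist_le (mem_univ x) (mem_univ 0))
    linarith
  refine ⟨K, (hf0 0).trans (hfK 0), fun S => ?_⟩
  have hle : volume.withDensity (fun x => ENNReal.ofReal (f x)) ≤ ENNReal.ofReal K • volume := by
    rw [← withDensity_const]
    exact withDensity_mono (Eventually.of_forall fun x => ENNReal.ofReal_le_ofReal (hfK x))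
  exact hle S

theorem exists_ae_pos_le {η : Measure ℝ} (hpos : η (Iic 0) = 0) (hsupp : IsCompact η.support) :
    ∃ R : ℝ, 0 < R ∧ ∀ᵐ x ∂η, 0 < x ∧ x ≤ R := by
  obtain ⟨R, hR⟩ := hsupp.bddAbove
  refine ⟨max R 1, by positivity, ?_⟩
  have h0 : ∀ᵐ x ∂η, x ∉ Iic (0 : ℝ) := measure_eq_zero_iff_ae_notMem.1 hpos
  filter_upwards [h0, Measure.support_mem_ae (μ := η)] with x hx hxs
  exact ⟨not_le.1 hx, (hR hxs).trans (le_max_left _ _)⟩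

theorem exists_Icc_subset_sumSet {m : ℕ} (d : Fin m → ℝ) {y : ℕ → ℝ} (hy0 : y 0 ≠ 0)
    (hy : Summable (weight 2 y)) (hy' : Summable (weight 2 fun j => y (j + 1)))
    (hv : 0 < volume (range (codedSum 2 d y)))
    (hv' : 0 < volume (range (codedSum 2 d fun j => y (j + 1)))) :
    ∃ a b : ℝ, a < b ∧ Icc a b ⊆ sumSet d y := by
  have hvol : 0 < volume ((fun x => y 0 * x) '' range (codedSum 2 d fun j => y (j + 1))) := by
    have := Measure.addHaar_smul (volume : Measure ℝ) (y 0)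
      (range (codedSum 2 d fun j => y (j + 1)))
    simp only [← image_smul, smul_eq_mul] at this
    rw [this]
    refine ENNReal.mul_pos ?_ hv'.ne'
    simpa using hy0
  obtain ⟨a, b, hab, h⟩ := exists_Icc_subset_add (isCompact_range_codedSum d hy).measurableSet
    ((isCompact_range_codedSum d hy').image (continuous_const_mul (y 0))).measurableSet hv hvol
  refine ⟨a, b, hab, fun x hx => ?_⟩
  obtain ⟨_, ⟨u, rfl⟩, _, ⟨_, ⟨v, rfl⟩, rfl⟩, rfl⟩ := h x hx
  exact add_mem_sumSet d hy hy' u v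

theorem corollary2p5 (m : ℕ) (hm : 1 ≤ m) (d : Fin m → ℝ) (hd : Function.Injective d)
    (η : Measure ℝ) [IsProbabilityMeasure η]
    (hpos : η (Iic 0) = 0)
    (hsupp : IsCompact η.support)
    (hbv : HasBVDensity η)
    (hχ : lyapunovExponent η < 0) :
    (∀ᵐ y ∂(Measure.infinitePi (fun _ : ℕ => η)),
      ∀ a : ℕ → Fin m, Summable (seriesTerm d y a)) ∧
    (Real.log m > 2 * |lyapunovExponent η| →
      ∀ᵐ y ∂(Measure.infinitePi (fun _ : ℕ => η)),
        ∃ a b : ℝ, a < b ∧ Icc a b ⊆ sumSet d y) ∧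
    (Real.log m ≤ |lyapunovExponent η| →
      ∀ᵐ y ∂(Measure.infinitePi (fun _ : ℕ => η)),
        dimH (sumSet d y) = ENNReal.ofReal (Real.log m / |lyapunovExponent η|)) := by
  have : NeZero m := ⟨by omega⟩
  obtain ⟨K, hK0, hK⟩ := hbv.exists_measure_le
  obtain ⟨R, hR, hηR⟩ := exists_ae_pos_le hpos hsupp
  -- a nonzero Bochner integral certifies integrability
  have hint : Integrable Real.log η := by
    by_contra h
    exact hχ.ne (integral_undef h)
  have habs : |lyapunovExponent η| = -lyapunovExponent η := abs_of_neg hχ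
  rw [habs]
  set χ := lyapunovExponent η
  set μ := Measure.infinitePi fun _ : ℕ => η
  have hposy : ∀ᵐ y ∂μ, ∀ i, 0 < y i := ae_all_iff.2 fun i =>
    (measurePreserving_eval_infinitePi (fun _ : ℕ => η) i).quasiMeasurePreserving.ae
      (hηR.mono fun x hx => hx.1)
  have hlim := ae_tendsto_average_log η hint
  have hsum : ∀ q : ℕ, 0 < q → ∀ᵐ y ∂μ, (∀ i, 0 < y i) ∧ Summable (weight q y) := fun q hq => by
    filter_upwards [hposy, hlim] with y hy hyl
    exact ⟨hy, summable_weight hq hy hχ hyl⟩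
  have hdecay : ∀ (q : ℕ) {l : ℝ}, -χ < l → ∀ᵐ y ∂μ, ∃ N : ℕ, y ∈ slowDecay q (q * l) (N + 1) := by
    intro q l hl
    filter_upwards [hposy, hlim] with y hy hyl
    exact exists_mem_slowDecay hy hyl (by linarith)
  refine ⟨?_, fun hlog => ?_, fun hlog => ?_⟩
  · filter_upwards [hsum 1 one_pos] with y hy a
    rw [seriesTerm_eq]
    exact (hasSum_codedSum d hy.2 a).summable
  · obtain ⟨l, hl1, hl2⟩ := exists_between (show -χ < Real.log m / 2 by linarith)
    have hvol := ae_volume_range_codedSum_pos η hK0 hK hR hηR two_pos (hsum 2 two_pos) hd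
      (l := (2 : ℕ) * l) (by push_cast; linarith) (by push_cast; linarith) (hdecay 2 hl1)
    have hshift : MeasurePreserving (fun (y : ℕ → ℝ) j => y (j + 1)) μ μ :=
      ⟨by fun_prop, Measure.map_infinitePi_infinitePi_of_inj (P := fun _ : ℕ => η)
        Nat.succ_injective⟩
    filter_upwards [hvol, hshift.quasiMeasurePreserving.ae hvol, hsum 2 two_pos,
      hshift.quasiMeasurePreserving.ae (hsum 2 two_pos)] with y h1 h2 h3 h4
    exact exists_Icc_subset_sumSet d (h3.1 0).ne' h3.2 h4.2 h1 h2
  · have hχ0 : 0 < -χ := by linarith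
    set α := Real.log m / -χ with hα
    have hupper : ∀ᵐ y ∂μ, dimH (range (codedSum 1 d y)) ≤ ENNReal.ofReal α := by
      filter_upwards [hposy, hlim] with y hy hyl
      refine le_of_forall_gt_imp_ge_of_dense fun c hc => ?_
      obtain ⟨t, ht, htc⟩ := ENNReal.lt_iff_exists_nnreal_btwn.1 hc
      refine le_trans ?_ htc.le
      rw [ENNReal.ofReal, ENNReal.coe_lt_coe, Real.toNNReal_lt_iff_lt_coe (by positivity), hα,
        div_lt_iff₀ hχ0] at ht
      obtain ⟨l, ⟨hl0, hlt⟩, hl⟩ : ∃ l : ℝ, (0 < l ∧ Real.log m < t * l) ∧ l < -χ := by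
        have h1 : ∀ᶠ l in 𝓝 (-χ), Real.log m < t * l :=
          continuousAt_const.eventually_lt (continuous_const_mul (t : ℝ)).continuousAt ht
        have h2 : ∀ᶠ l in 𝓝 (-χ), 0 < l := eventually_gt_nhds hχ0
        exact (((h2.and h1).filter_mono nhdsWithin_le_nhds).and
          (self_mem_nhdsWithin (s := Iio (-χ)))).exists
      obtain ⟨C, hC⟩ := exists_weight_le hy hyl (l := l) (by linarith)
      exact dimH_range_codedSum_le d hl0 hC hlt
    have hlower : ∀ᵐ y ∂μ, ENNReal.ofReal α ≤ dimH (range (codedSum 1 d y)) := by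
      rcases le_or_gt α 0 with h0 | h0
      · simp [ENNReal.ofReal_of_nonpos h0]
      obtain ⟨u, -, hu, hulim⟩ := exists_seq_strictMono_tendsto' (Real.toNNReal_pos.2 h0)
      have hu' : ∀ n, ∀ᵐ y ∂μ, (u n : ℝ≥0∞) ≤ dimH (range (codedSum 1 d y)) := by
        intro n
        have hlt : (u n : ℝ) < α := Real.lt_toNNReal_iff_coe_lt.1 (hu n).2
        have hα1 : α ≤ 1 := by rwa [hα, div_le_one hχ0]
        have hlt' := hlt
        rw [hα, lt_div_iff₀ hχ0] at hlt'
        obtain ⟨l, hl, hl'⟩ : ∃ l : ℝ, u n * l < Real.log m ∧ -χ < l := by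
          have h1 : ∀ᶠ l in 𝓝 (-χ), u n * l < Real.log m :=
            (continuous_const_mul (u n : ℝ)).continuousAt.eventually_lt continuousAt_const hlt'
          exact ((h1.filter_mono nhdsWithin_le_nhds).and
            (self_mem_nhdsWithin (s := Ioi (-χ)))).exists
        refine ae_le_dimH_range_codedSum η hK0 hK hR hηR one_pos (hsum 1 one_pos) hd (hu n).1
          (by exact_mod_cast hlt.trans_le hα1) (l := (1 : ℕ) * l) ?_ ?_ (hdecay 1 hl')
        · push_cast; linarith
        · push_cast; linarith
      filter_upwards [ae_all_iff.2 hu'] with y hy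
      exact le_of_tendsto' (ENNReal.tendsto_coe.2 hulim) hy
    filter_upwards [hupper, hlower, hsum 1 one_pos] with y h1 h2 hy
    rw [sumSet_eq_range_codedSum d hy.2]
    exact le_antisymm h1 h2
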